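/- Let $\mathbb D$ be the open unit disc in $\mathbb C$ and $dA=dx\,dy/\pi$ the normalized area measure on $\mathbb D$. For $f$ analytic on $\mathbb D$ let $\mathcal D(f)=\int_{\mathbb D}|f'(z)|^2\,dA(z)\in[0,\infty]$, and let the Dirichlet space $\mathcal D$ be the space of all analytic functions $f$ on $\mathbb D$ with $\mathcal D(f)<\infty$, endowed with the norm $\|f\|_{\mathcal D}=\bigl(|f(0)|^2+\mathcal D(f)\bigr)^{1/2}$. Let $\varphi:\mathbb D\to\mathbb D$ be an analytic function with $\varphi\in\mathcal D$, let $\varphi^n$ denote its $n$-th pointwise power, $\varphi^n(z)=(\varphi(z))^n$, and let $C_\varphi f=f\circ\varphi$. (a) If $\sup_{n\ge 1}\mathcal D(\varphi^n)<\infty$, then $C_\varphi$ maps $\mathcal D$ into $\mathcal D$ and is a bounded operator on $\mathcal D$. (b) If $\lim_{n\to\infty}\mathcal D(\varphi^n)=0$, then $C_\varphi$ maps $\mathcal D$ into $\mathcal D$ and is a compact bounded operator on $\mathcal D$. -/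

import Mathlib

noncomputable section

namespace DirichletComposition

open MeasureTheory Metric
open scoped ENNReal Complex.UnitDisc

/-- The extension by zero to `ℂ` of a function on the open unit disc. -/
def zeroExtend (f : 𝔻 → ℂ) (z : ℂ) : ℂ :=
  if h : ‖z‖ < 1 then f (Complex.UnitDisc.mk z h) else 0

/-- `f` is analytic on the open unit disc. -/
def IsHolomorphic (f : 𝔻 → ℂ) : Prop :=
  DifferentiableOn ℂ (zeroExtend f) (ball 0 1)

/-- The normalized area measure `dA = dx dy / π` on the open unit disc. -/
def areaMeasure : Measure ℂ :=
  (ENNReal.ofReal Real.pi)⁻¹ • (volume : Measure ℂ).restrict (ball 0 1)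

/-- The Dirichlet integral `∫_𝔻 |f'|² dA`, with values in `[0, ∞]`. -/
def dirichletIntegral (f : 𝔻 → ℂ) : ℝ≥0∞ :=
  ∫⁻ z, ‖deriv (zeroExtend f) z‖ₑ ^ 2 ∂areaMeasure

/-- `f` belongs to the Dirichlet space. -/
def MemDirichlet (f : 𝔻 → ℂ) : Prop :=
  IsHolomorphic f ∧ dirichletIntegral f < ∞

theorem zeroExtend_coe (f : 𝔻 → ℂ) (z : 𝔻) : zeroExtend f (z : ℂ) = f z := by
  simp [zeroExtend, z.norm_lt_one]

theorem zeroExtend_zero : zeroExtend 0 = 0 := by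
  ext z; simp [zeroExtend]

theorem zeroExtend_add (f g : 𝔻 → ℂ) :
    zeroExtend (f + g) = zeroExtend f + zeroExtend g := by
  ext z; by_cases h : ‖z‖ < 1 <;> simp [zeroExtend, h]

theorem zeroExtend_smul (c : ℂ) (f : 𝔻 → ℂ) :
    zeroExtend (c • f) = c • zeroExtend f := by
  ext z; by_cases h : ‖z‖ < 1 <;> simp [zeroExtend, h]

theorem ae_mem_ball : ∀ᵐ z ∂areaMeasure, z ∈ ball (0 : ℂ) 1 :=
  Measure.ae_smul_measure (ae_restrict_mem measurableSet_ball) _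

theorem IsHolomorphic.differentiableAt {f : 𝔻 → ℂ} (hf : IsHolomorphic f) {z : ℂ}
    (hz : z ∈ ball (0 : ℂ) 1) : DifferentiableAt ℂ (zeroExtend f) z :=
  DifferentiableOn.differentiableAt hf (isOpen_ball.mem_nhds hz)

theorem deriv_add_ae {f g : 𝔻 → ℂ} (hf : IsHolomorphic f) (hg : IsHolomorphic g) :
    deriv (zeroExtend (f + g)) =ᵐ[areaMeasure]
      deriv (zeroExtend f) + deriv (zeroExtend g) := by
  filter_upwards [ae_mem_ball] with z hz
  rw [zeroExtend_add, deriv_add (hf.differentiableAt hz) (hg.differentiableAt hz)]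
  rfl

theorem deriv_smul_ae {f : 𝔻 → ℂ} (c : ℂ) (hf : IsHolomorphic f) :
    deriv (zeroExtend (c • f)) =ᵐ[areaMeasure] c • deriv (zeroExtend f) := by
  filter_upwards [ae_mem_ball] with z hz
  rw [zeroExtend_smul, deriv_const_smul _ (hf.differentiableAt hz)]
  rfl

theorem eLpNorm_sq (f : 𝔻 → ℂ) :
    eLpNorm (deriv (zeroExtend f)) 2 areaMeasure ^ 2 = dirichletIntegral f := by
  have := eLpNorm_nnreal_pow_eq_lintegral (f := deriv (zeroExtend f)) (μ := areaMeasure)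
    (p := 2) two_ne_zero
  simpa [dirichletIntegral] using this

theorem memLp_iff (f : 𝔻 → ℂ) :
    MemLp (deriv (zeroExtend f)) 2 areaMeasure ↔ dirichletIntegral f < ∞ := by
  rw [← eLpNorm_sq]
  simp [MemLp, (measurable_deriv (zeroExtend f)).aestronglyMeasurable]

/-- The Dirichlet space as a subspace of the vector space of all functions on the disc. -/
def dirichletSubmodule : Submodule ℂ (𝔻 → ℂ) where
  carrier := {f | MemDirichlet f}
  zero_mem' := by
    refine ⟨?_, ?_⟩
    · rw [IsHolomorphic, zeroExtend_zero]
      exact differentiableOn_const 0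
    · rw [dirichletIntegral, zeroExtend_zero]
      simp
  add_mem' := by
    rintro f g ⟨hf, hf'⟩ ⟨hg, hg'⟩
    refine ⟨?_, ?_⟩
    · rw [IsHolomorphic, zeroExtend_add]
      exact hf.add hg
    · rw [← memLp_iff] at hf' hg' ⊢
      exact (memLp_congr_ae (deriv_add_ae hf hg)).2 (hf'.add hg')
  smul_mem' := by
    rintro c f ⟨hf, hf'⟩
    refine ⟨?_, ?_⟩
    · rw [IsHolomorphic, zeroExtend_smul]
      exact hf.const_smul c
    · rw [← memLp_iff] at hf' ⊢
      exact (memLp_congr_ae (deriv_smul_ae c hf)).2 (hf'.const_smul c)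

/-- The Dirichlet space. It is a type of its own, so that it carries only the topology of the norm
below and not the topology of pointwise convergence. -/
def DirichletSpace : Type := dirichletSubmodule

namespace DirichletSpace

instance : AddCommGroup DirichletSpace := inferInstanceAs (AddCommGroup dirichletSubmodule)

instance : Module ℂ DirichletSpace := inferInstanceAs (Module ℂ dirichletSubmodule)

instance : CoeFun DirichletSpace (fun _ => 𝔻 → ℂ) := ⟨Subtype.val⟩

/-- The norm `‖f‖ = (|f(0)|² + ∫_𝔻 |f'|² dA)^{1/2}`. -/
instance : Norm DirichletSpace :=
  ⟨fun f => Real.sqrt (‖f 0‖ ^ 2 + (dirichletIntegral f).toReal)⟩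

theorem memDirichlet (f : DirichletSpace) : MemDirichlet f := f.2

theorem memLp_deriv (f : DirichletSpace) : MemLp (deriv (zeroExtend f)) 2 areaMeasure :=
  (memLp_iff f).2 f.memDirichlet.2

/-- The map `f ↦ (f(0), f')`. -/
def toProd : DirichletSpace →ₗ[ℂ] WithLp 2 (ℂ × Lp ℂ 2 areaMeasure) where
  toFun f := WithLp.toLp 2 (f 0, f.memLp_deriv.toLp _)
  map_add' f g := by
    rw [← WithLp.toLp_add, Prod.mk_add_mk, ← MemLp.toLp_add]
    congr 2
    exact MemLp.toLp_congr _ _ (deriv_add_ae f.memDirichlet.1 g.memDirichlet.1)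
  map_smul' c f := by
    rw [RingHom.id_apply, ← WithLp.toLp_smul, Prod.smul_mk, ← MemLp.toLp_const_smul]
    congr 2
    exact MemLp.toLp_congr _ _ (deriv_smul_ae c f.memDirichlet.1)

theorem norm_toProd (f : DirichletSpace) : ‖toProd f‖ = ‖f‖ := by
  rw [WithLp.prod_norm_eq_of_L2]
  change Real.sqrt (‖f 0‖ ^ 2 + ‖f.memLp_deriv.toLp _‖ ^ 2) = _
  rw [Lp.norm_toLp, ← ENNReal.toReal_pow, eLpNorm_sq]
  rfl

theorem toProd_injective : Function.Injective toProd := by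
  rw [injective_iff_map_eq_zero]
  intro f hf
  have h0 : f 0 = 0 := congrArg WithLp.fst hf
  have h1 : f.memLp_deriv.toLp _ = 0 := congrArg WithLp.snd hf
  have hπ : (ENNReal.ofReal Real.pi)⁻¹ ≠ 0 := ENNReal.inv_ne_zero.2 ENNReal.ofReal_ne_top
  have h2 : deriv (zeroExtend f) =ᵐ[volume.restrict (ball 0 1)] 0 := by
    have := (MemLp.toLp_eq_toLp_iff f.memLp_deriv MemLp.zero).1 (h1.trans (MemLp.toLp_zero _).symm)
    exact (Measure.ae_ennreal_smul_measure_iff hπ).1 this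
  have hd : DifferentiableOn ℂ (zeroExtend f) (ball 0 1) := f.memDirichlet.1
  have h3 : Set.EqOn (deriv (zeroExtend f)) 0 (ball 0 1) :=
    Measure.eqOn_open_of_ae_eq h2 isOpen_ball
      (hd.deriv isOpen_ball).continuousOn continuousOn_const
  refine Subtype.ext (funext fun z => ?_)
  have h4 := isOpen_ball.is_const_of_deriv_eq_zero (convex_ball (0 : ℂ) 1).isPreconnected hd h3
    (x := (z : ℂ)) (y := ((0 : 𝔻) : ℂ)) (mem_ball_zero_iff.2 z.norm_lt_one)
    (mem_ball_zero_iff.2 (Complex.UnitDisc.norm_lt_one 0))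
  rw [zeroExtend_coe, zeroExtend_coe] at h4
  exact h4.trans h0

theorem normedSpaceCore : NormedSpace.Core ℂ DirichletSpace where
  norm_nonneg f := Real.sqrt_nonneg _
  norm_smul c f := by rw [← norm_toProd, ← norm_toProd, map_smul, norm_smul]
  norm_triangle f g := by
    rw [← norm_toProd, ← norm_toProd, ← norm_toProd, map_add]
    exact norm_add_le _ _
  norm_eq_zero_iff f := by
    rw [← norm_toProd, norm_eq_zero, map_eq_zero_iff _ toProd_injective]

instance : NormedAddCommGroup DirichletSpace := NormedAddCommGroup.ofCore normedSpaceCore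

instance : NormedSpace ℂ DirichletSpace := NormedSpace.ofCore normedSpaceCore

end DirichletSpace

/-- The linear map `T` on the Dirichlet space is the composition operator `f ↦ f ∘ φ`. Since `T` is
determined by `φ`, the existence of such a `T` says that `f ∘ φ` lies in the Dirichlet space for
every `f` in it. -/
def IsCompositionOperator (φ : 𝔻 → 𝔻) (T : DirichletSpace →ₗ[ℂ] DirichletSpace) : Prop :=
  ∀ (f : DirichletSpace) (z : 𝔻), T f z = f (φ z)

/-- The composition operator with symbol `φ` is defined and bounded on the Dirichlet space. -/
def CompositionBounded (φ : 𝔻 → 𝔻) : Prop :=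
  ∃ T : DirichletSpace →L[ℂ] DirichletSpace, IsCompositionOperator φ T

/-- The composition operator with symbol `φ` is defined, bounded and compact on the
Dirichlet space. -/
def CompositionCompact (φ : 𝔻 → 𝔻) : Prop :=
  ∃ T : DirichletSpace →L[ℂ] DirichletSpace, IsCompositionOperator φ T ∧ IsCompactOperator T

end DirichletComposition

end

/-! Let `μ` be the image under `φ` of `|φ'|² dA`. The chain rule gives `D(f ∘ φ) = ∫ |f'|² dμ`
(`dirichletIntegral_comp`), and in particular `D(φⁿ) = ∫ n² |w|^(2n-2) dμ(w)`. Both parts thus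
compare `μ` with area measure on the derivatives `f'`, which form a Bergman space.

Taking `n` of order `1/h`, the moment bounds the `μ`-mass of the annulus `1 - h ≤ |w|` by a constant
times `h² D(φⁿ)` (`annulus_le_moment`). Such a bound for all `h` makes `μ` a Carleson measure
(`lintegral_enorm_sq_le_of_annulus_le`): apply the sub-mean value property of `|g|²` on discs
comparable to the distance to the boundary, then Tonelli. This gives (a); the value `f(φ(0))` is
controlled by a pointwise estimate.

For (b), `D(φⁿ) → 0` makes the Carleson constant of `μ` near the boundary arbitrarily small. A
sequence in the unit ball has a locally uniformly convergent subsequence whose limit stays in the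
ball (Arzelà–Ascoli and Fatou). Its images converge in norm: the outer annulus contributes little,
and on the remaining compact disc the derivatives converge uniformly. -/

noncomputable section

namespace DirichletComposition

open MeasureTheory Metric Filter Topology
open scoped ENNReal Complex.UnitDisc

/-! ### Sub-mean value inequalities -/

/-- The modulus of a holomorphic function at the centre of a circle is at most its mean. -/
theorem two_pi_mul_enorm_le_lintegral_circleMap {g : ℂ → ℂ} {w : ℂ} {R s : ℝ}
    (hg : DifferentiableOn ℂ g (ball w R)) (hs : 0 < s) (hsR : s < R) :
    ENNReal.ofReal (2 * Real.pi) * ‖g w‖ₑ ≤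
      ∫⁻ θ in Set.Ioo (-Real.pi) Real.pi, ‖g (circleMap w s θ)‖ₑ := by
  have hd : DiffContOnCl ℂ g (ball w |s|) := by
    rw [abs_of_pos hs]
    exact (hg.mono (closedBall_subset_ball hsR)).diffContOnCl_ball subset_rfl
  have h1 := hd.circleAverage
  rw [Real.circleAverage] at h1
  have hper : Function.Periodic (fun θ => g (circleMap w s θ)) (2 * Real.pi) := fun θ => by
    simp only [periodic_circleMap w s θ]
  -- Shift the period to `(-π, π)`, the angular range of `polarCoord`.
  have h2 := hper.intervalIntegral_add_eq 0 (-Real.pi)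
  rw [zero_add, show -Real.pi + 2 * Real.pi = Real.pi by ring] at h2
  rw [h2, intervalIntegral.integral_of_le (by linarith [Real.pi_pos])] at h1
  have hpi : (0 : ℝ) < 2 * Real.pi := by positivity
  have h3 : (2 * Real.pi) • g w =
      ∫ θ in Set.Ioc (-Real.pi) Real.pi, g (circleMap w s θ) := by
    rw [← h1, smul_inv_smul₀ hpi.ne']
  calc ENNReal.ofReal (2 * Real.pi) * ‖g w‖ₑ = ‖(2 * Real.pi) • g w‖ₑ := by
        rw [enorm_smul, Real.enorm_of_nonneg hpi.le]
    _ ≤ ∫⁻ θ in Set.Ioc (-Real.pi) Real.pi, ‖g (circleMap w s θ)‖ₑ := by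
        rw [h3]; exact enorm_integral_le_lintegral_enorm _
    _ = _ := by rw [restrict_Ioo_eq_restrict_Ioc]

/-- The area sub-mean value property of the modulus of a holomorphic function. -/
theorem enorm_le_lintegral_ball {g : ℂ → ℂ} {w : ℂ} {R : ℝ} (hR : 0 ≤ R) (hm : Measurable g)
    (hg : DifferentiableOn ℂ g (ball w R)) :
    ENNReal.ofReal (Real.pi * R ^ 2) * ‖g w‖ₑ ≤ ∫⁻ z in ball w R, ‖g z‖ₑ := by
  set F : ℂ → ℝ≥0∞ := (ball w R).indicator fun z => ‖g z‖ₑ with hF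
  have hFm : Measurable F := hm.enorm.indicator measurableSet_ball
  have hsymm : ∀ p : ℝ × ℝ, w + Complex.polarCoord.symm p = circleMap w p.1 p.2 := fun p => by
    rw [Complex.polarCoord_symm_apply, circleMap, Complex.exp_mul_I]
    push_cast; rfl
  have hint : ∫⁻ s in Set.Ioo 0 R, ENNReal.ofReal s = ENNReal.ofReal (R ^ 2 / 2) := by
    rw [restrict_Ioo_eq_restrict_Ioc, ← ofReal_integral_eq_lintegral_ofReal]
    · rw [← intervalIntegral.integral_of_le hR, integral_id]; simp
    · exact (continuous_id.integrableOn_Icc).mono_set Set.Ioc_subset_Icc_self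
    · exact (ae_restrict_mem measurableSet_Ioc).mono fun s hs => hs.1.le
  have hcm : Measurable fun p : ℝ × ℝ => circleMap w p.1 p.2 := by
    refine Continuous.measurable ?_
    unfold circleMap; fun_prop
  calc ENNReal.ofReal (Real.pi * R ^ 2) * ‖g w‖ₑ
      = (∫⁻ s in Set.Ioo 0 R, ENNReal.ofReal s) * (ENNReal.ofReal (2 * Real.pi) * ‖g w‖ₑ) := by
        rw [hint, ← mul_assoc, ← ENNReal.ofReal_mul (by positivity)]
        congr 2; ring
    _ = ∫⁻ s in Set.Ioo 0 R, ENNReal.ofReal s * (ENNReal.ofReal (2 * Real.pi) * ‖g w‖ₑ) := by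
        rw [lintegral_mul_const _ ENNReal.measurable_ofReal]
    _ ≤ ∫⁻ s in Set.Ioo 0 R, ∫⁻ θ in Set.Ioo (-Real.pi) Real.pi,
          ENNReal.ofReal s * F (circleMap w s θ) := by
        refine setLIntegral_mono' measurableSet_Ioo fun s hs => ?_
        rw [lintegral_const_mul' _ _ ENNReal.ofReal_ne_top]
        gcongr
        refine (two_pi_mul_enorm_le_lintegral_circleMap hg hs.1 hs.2).trans (le_of_eq ?_)
        refine lintegral_congr fun θ => ?_
        rw [hF, Set.indicator_of_mem]
        simpa [circleMap, abs_of_pos hs.1] using hs.2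
    _ ≤ ∫⁻ s in Set.Ioi 0, ∫⁻ θ in Set.Ioo (-Real.pi) Real.pi,
          ENNReal.ofReal s * F (circleMap w s θ) :=
        lintegral_mono_set Set.Ioo_subset_Ioi_self
    _ = ∫⁻ p in polarCoord.target, ENNReal.ofReal p.1 • F (w + Complex.polarCoord.symm p) := by
        rw [polarCoord_target, Measure.volume_eq_prod, ← Measure.prod_restrict, lintegral_prod]
        · simp only [hsymm, smul_eq_mul]
        · simp only [hsymm, smul_eq_mul]
          exact ((measurable_fst.ennreal_ofReal).mul (hFm.comp hcm)).aemeasurable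
    _ = ∫⁻ z in ball w R, ‖g z‖ₑ := by
        rw [Complex.lintegral_comp_polarCoord_symm fun z => F (w + z),
          lintegral_add_left_eq_self F w, hF, lintegral_indicator measurableSet_ball]

/-- The square `g²` is again holomorphic. -/
theorem enorm_sq_le_lintegral_ball {g : ℂ → ℂ} {w : ℂ} {R : ℝ} (hR : 0 ≤ R) (hm : Measurable g)
    (hg : DifferentiableOn ℂ g (ball w R)) :
    ENNReal.ofReal (Real.pi * R ^ 2) * ‖g w‖ₑ ^ 2 ≤ ∫⁻ z in ball w R, ‖g z‖ₑ ^ 2 := by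
  have := enorm_le_lintegral_ball (g := fun z => g z ^ 2) hR (hm.pow_const 2) (hg.pow 2)
  simpa only [enorm_pow] using this

/-! ### Carleson embedding from the masses of annuli -/

theorem lintegral_areaMeasure (F : ℂ → ℝ≥0∞) :
    ∫⁻ z in ball 0 1, F z = ENNReal.ofReal Real.pi * ∫⁻ z, F z ∂areaMeasure := by
  rw [areaMeasure, lintegral_smul_measure, smul_eq_mul, ← mul_assoc,
    ENNReal.mul_inv_cancel (by simp [Real.pi_pos]) ENNReal.ofReal_ne_top, one_mul]

/-- A measure on the disc whose mass near the boundary is `O(h²)` on the annulus of width `h` is a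
Carleson measure for the Bergman space. -/
theorem lintegral_enorm_sq_le_of_annulus_le {μ : Measure ℂ} [SFinite μ] {C : ℝ≥0∞}
    (hμ0 : ∀ᵐ w ∂μ, w ∈ ball (0 : ℂ) 1)
    (hμ : ∀ h : ℝ, 0 < h → μ {w | 1 - h ≤ ‖w‖} ≤ C * ENNReal.ofReal (h ^ 2))
    {g : ℂ → ℂ} (hm : Measurable g) (hg : DifferentiableOn ℂ g (ball 0 1)) :
    ∫⁻ w, ‖g w‖ₑ ^ 2 ∂μ ≤ 36 * C * ∫⁻ z, ‖g z‖ₑ ^ 2 ∂areaMeasure := by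
  -- Pairs `(w, z)` with `z` in the disc about `w` of half the distance from `w` to the unit circle;
  -- `k w` is the reciprocal area of that disc.
  set S : Set (ℂ × ℂ) := {p | ‖p.1‖ < 1 ∧ dist p.2 p.1 < (1 - ‖p.1‖) / 2} with hS
  have hSm : MeasurableSet S := by
    refine MeasurableSet.inter ?_ ?_
    · exact measurableSet_lt measurable_fst.norm measurable_const
    · exact measurableSet_lt (measurable_snd.dist measurable_fst)
        ((measurable_const.sub measurable_fst.norm).div_const _)
  set k : ℂ → ℝ≥0∞ := fun w => (ENNReal.ofReal (Real.pi * ((1 - ‖w‖) / 2) ^ 2))⁻¹ with hk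
  have hkm : Measurable k := by rw [hk]; fun_prop
  set Φ : ℂ → ℂ → ℝ≥0∞ := fun w z => S.indicator (fun p => k p.1 * ‖g p.2‖ₑ ^ 2) (w, z) with hΦ
  have hΦm : Measurable (Function.uncurry Φ) := by
    refine Measurable.indicator ?_ hSm
    exact (hkm.comp measurable_fst).mul ((hm.comp measurable_snd).enorm.pow_const 2)
  have hpt : ∀ᵐ w ∂μ, ‖g w‖ₑ ^ 2 ≤ ∫⁻ z in ball 0 1, Φ w z := by
    filter_upwards [hμ0] with w hw
    have hw' : ‖w‖ < 1 := by simpa using hw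
    set r := (1 - ‖w‖) / 2 with hr
    have hr0 : 0 < r := by rw [hr]; linarith
    have hsub : ball w r ⊆ ball 0 1 := by
      refine ball_subset_ball' ?_
      rw [dist_zero_right]; linarith
    have hΦw : ∀ z ∈ ball w r, Φ w z = k w * ‖g z‖ₑ ^ 2 := fun z hz => by
      rw [hΦ]
      exact Set.indicator_of_mem (s := S) (a := (w, z)) ⟨hw', hz⟩ _
    calc ‖g w‖ₑ ^ 2 = k w * (ENNReal.ofReal (Real.pi * r ^ 2) * ‖g w‖ₑ ^ 2) := by
          rw [hk, ← mul_assoc, ENNReal.inv_mul_cancel, one_mul]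
          · exact (ENNReal.ofReal_pos.2 (by positivity)).ne'
          · exact ENNReal.ofReal_ne_top
      _ ≤ k w * ∫⁻ z in ball w r, ‖g z‖ₑ ^ 2 := by
          gcongr
          exact enorm_sq_le_lintegral_ball hr0.le hm (hg.mono hsub)
      _ = ∫⁻ z in ball w r, Φ w z := by
          rw [setLIntegral_congr_fun measurableSet_ball hΦw, lintegral_const_mul]
          exact hm.enorm.pow_const 2
      _ ≤ ∫⁻ z in ball 0 1, Φ w z := lintegral_mono_set hsub
  -- On `S`, with `h = 1 - |z|`, one has `2h/3 < 1 - |w| < 2h`. So `w` lies in the annulus of width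
  -- `2h`, `k w` is at most `1/(π (h/3)²)`, and `36 = (2h)²/(h/3)²`. The width `2h` may exceed `1`,
  -- so `hμ` is needed for all `h > 0`.
  have hinner : ∀ z ∈ ball (0 : ℂ) 1,
      ∫⁻ w, Φ w z ∂μ ≤ (ENNReal.ofReal Real.pi)⁻¹ * (36 * C) * ‖g z‖ₑ ^ 2 := by
    intro z hz
    have hz' : ‖z‖ < 1 := by simpa using hz
    set h := 1 - ‖z‖ with hh
    have hh0 : 0 < h := by linarith
    set A : Set ℂ := {w | 1 - 2 * h ≤ ‖w‖} with hA
    have hAm : MeasurableSet A := measurableSet_le measurable_const measurable_norm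
    set c : ℝ≥0∞ := (ENNReal.ofReal (Real.pi * (h / 3) ^ 2))⁻¹ * ‖g z‖ₑ ^ 2 with hc
    have hle : ∀ w, Φ w z ≤ A.indicator (fun _ => c) w := by
      intro w
      by_cases hw : (w, z) ∈ S
      · have h1 : dist z w < (1 - ‖w‖) / 2 := hw.2
        have h1' : ‖w‖ < 1 := hw.1
        have h2 : |‖z‖ - ‖w‖| ≤ dist z w := by rw [dist_eq_norm]; exact abs_norm_sub_norm_le z w
        have h3 := abs_le.1 h2
        rw [Set.indicator_of_mem (show w ∈ A by rw [hA, Set.mem_ofPred_eq]; linarith)]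
        rw [hΦ]
        simp only [Set.indicator_of_mem hw]
        simp only [hc, hk]
        gcongr ?_ * _
        refine ENNReal.inv_le_inv.2 (ENNReal.ofReal_le_ofReal ?_)
        gcongr Real.pi * ?_ ^ 2
        linarith
      · rw [hΦ]
        simp only [Set.indicator_of_notMem hw]
        exact zero_le
    calc ∫⁻ w, Φ w z ∂μ ≤ ∫⁻ w, A.indicator (fun _ => c) w ∂μ := lintegral_mono hle
      _ = c * μ A := lintegral_indicator_const hAm c
      _ ≤ c * (C * ENNReal.ofReal ((2 * h) ^ 2)) := by gcongr; exact hμ _ (by linarith)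
      _ = (ENNReal.ofReal (Real.pi * (h / 3) ^ 2))⁻¹ * ENNReal.ofReal ((2 * h) ^ 2) * C
            * ‖g z‖ₑ ^ 2 := by rw [hc]; ring
      _ = _ := by
          congr 1
          rw [← mul_assoc, ← ENNReal.ofReal_inv_of_pos (by positivity),
            ← ENNReal.ofReal_inv_of_pos (by positivity),
            show (36 : ℝ≥0∞) = ENNReal.ofReal 36 by simp,
            ← ENNReal.ofReal_mul (by positivity), ← ENNReal.ofReal_mul (by positivity)]
          congr 2
          field_simp
          norm_num
  calc ∫⁻ w, ‖g w‖ₑ ^ 2 ∂μ ≤ ∫⁻ w, (∫⁻ z in ball 0 1, Φ w z) ∂μ := lintegral_mono_ae hpt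
    _ = ∫⁻ z in ball 0 1, ∫⁻ w, Φ w z ∂μ := lintegral_lintegral_swap hΦm.aemeasurable
    _ ≤ ∫⁻ z in ball 0 1, (ENNReal.ofReal Real.pi)⁻¹ * (36 * C) * ‖g z‖ₑ ^ 2 :=
        setLIntegral_mono' measurableSet_ball hinner
    _ = 36 * C * ∫⁻ z, ‖g z‖ₑ ^ 2 ∂areaMeasure := by
        rw [lintegral_const_mul _ (hm.enorm.pow_const 2), lintegral_areaMeasure]
        have : (ENNReal.ofReal Real.pi)⁻¹ * ENNReal.ofReal Real.pi = 1 :=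
          ENNReal.inv_mul_cancel (by simp [Real.pi_pos]) ENNReal.ofReal_ne_top
        rw [mul_comm _ (36 * C), mul_assoc, ← mul_assoc _ (ENNReal.ofReal Real.pi), this, one_mul]

/-- The mass of an annulus is controlled by a moment `∫ n² |w|^(2n-2) dμ`. -/
theorem annulus_le_moment (μ : Measure ℂ) {h : ℝ} (hh : 0 < h) :
    μ {w | 1 - h ≤ ‖w‖} ≤ 32 * (∫⁻ w, ‖((⌊1 / (4 * h)⌋₊ + 1 : ℕ) : ℂ) * w ^ ⌊1 / (4 * h)⌋₊‖ₑ ^ 2 ∂μ)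
      * ENNReal.ofReal (h ^ 2) := by
  -- This `m` satisfies `m h ≤ 1/4 ≤ (m + 1) h`. On the annulus Bernoulli's inequality gives
  -- `|w|^(2m) ≥ 1 - 2mh ≥ 1/2`, while `(m + 1)² h² ≥ 1/16`; hence the constant `32`.
  set m := ⌊1 / (4 * h)⌋₊ with hm
  have hm1 : (m : ℝ) * h ≤ 1 / 4 := by
    have : (m : ℝ) ≤ 1 / (4 * h) := Nat.floor_le (by positivity)
    rw [le_div_iff₀ (by positivity)] at this
    linarith
  have hm2 : 1 / 4 ≤ ((m + 1 : ℕ) : ℝ) * h := by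
    have : 1 / (4 * h) < (m : ℝ) + 1 := Nat.lt_floor_add_one _
    rw [div_lt_iff₀ (by positivity)] at this
    push_cast; linarith
  have hAm : MeasurableSet {w : ℂ | 1 - h ≤ ‖w‖} :=
    measurableSet_le measurable_const measurable_norm
  have hpt : ∀ w ∈ {w : ℂ | 1 - h ≤ ‖w‖},
      1 ≤ ENNReal.ofReal (32 * h ^ 2) * ‖((m + 1 : ℕ) : ℂ) * w ^ m‖ₑ ^ 2 := by
    intro w hw
    have hw' : 1 - h ≤ ‖w‖ := hw
    have hb : 1 + ((2 * m : ℕ) : ℝ) * (‖w‖ - 1) ≤ (1 + (‖w‖ - 1)) ^ (2 * m) :=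
      one_add_mul_le_pow (by linarith [norm_nonneg w]) _
    rw [add_sub_cancel, mul_comm 2 m, pow_mul] at hb
    push_cast at hb
    have hb2 : 1 / 2 ≤ (‖w‖ ^ m) ^ 2 := by
      have : (m : ℝ) * (-h) ≤ m * (‖w‖ - 1) := by gcongr; linarith
      linarith
    rw [← ofReal_norm, ← ENNReal.ofReal_pow (norm_nonneg _), ← ENNReal.ofReal_mul (by positivity),
      ENNReal.one_le_ofReal, norm_mul, norm_pow, Complex.norm_natCast]
    have h16 : 1 / 16 ≤ (((m + 1 : ℕ) : ℝ) * h) ^ 2 := by nlinarith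
    calc (1 : ℝ) = 32 * (1 / 16 * (1 / 2)) := by norm_num
      _ ≤ 32 * ((((m + 1 : ℕ) : ℝ) * h) ^ 2 * (‖w‖ ^ m) ^ 2) := by gcongr
      _ = _ := by ring
  calc μ {w | 1 - h ≤ ‖w‖} = ∫⁻ _ in {w : ℂ | 1 - h ≤ ‖w‖}, 1 ∂μ := by simp
    _ ≤ ∫⁻ w in {w : ℂ | 1 - h ≤ ‖w‖},
          ENNReal.ofReal (32 * h ^ 2) * ‖((m + 1 : ℕ) : ℂ) * w ^ m‖ₑ ^ 2 ∂μ :=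
        setLIntegral_mono' hAm hpt
    _ ≤ ∫⁻ w, ENNReal.ofReal (32 * h ^ 2) * ‖((m + 1 : ℕ) : ℂ) * w ^ m‖ₑ ^ 2 ∂μ :=
        setLIntegral_le_lintegral _ _
    _ = _ := by
        rw [lintegral_const_mul' _ _ ENNReal.ofReal_ne_top, ENNReal.ofReal_mul (by norm_num)]
        simp only [ENNReal.ofReal_ofNat]
        ring

/-! ### Composition with `φ` and the image measure -/

theorem zeroExtend_of_mem (f : 𝔻 → ℂ) {z : ℂ} (hz : ‖z‖ < 1) :
    zeroExtend f z = f (Complex.UnitDisc.mk z hz) := by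
  simp [zeroExtend, hz]

theorem IsHolomorphic.measurable {f : 𝔻 → ℂ} (hf : IsHolomorphic f) :
    Measurable (zeroExtend f) := by
  refine measurable_of_restrict_of_restrict_compl measurableSet_ball
    (DifferentiableOn.continuousOn hf).domRestrict.measurable ?_
  convert measurable_const (a := (0 : ℂ)) using 1
  ext z
  have hz : ¬ ‖(z : ℂ)‖ < 1 := fun h => z.2 (mem_ball_zero_iff.2 h)
  simp [zeroExtend, hz]

theorem IsHolomorphic.differentiableOn_deriv {f : 𝔻 → ℂ} (hf : IsHolomorphic f) :
    DifferentiableOn ℂ (deriv (zeroExtend f)) (ball 0 1) :=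
  DifferentiableOn.deriv hf isOpen_ball

theorem isHolomorphic_pow (n : ℕ) : IsHolomorphic fun z => (z : ℂ) ^ n := by
  refine (differentiableOn_pow n).congr fun z hz => ?_
  rw [zeroExtend_of_mem _ (mem_ball_zero_iff.1 hz), Complex.UnitDisc.coe_mk]

theorem deriv_zeroExtend_pow (n : ℕ) {z : ℂ} (hz : z ∈ ball (0 : ℂ) 1) :
    deriv (zeroExtend fun z => (z : ℂ) ^ n) z = n * z ^ (n - 1) := by
  have h : (zeroExtend fun z => (z : ℂ) ^ n) =ᶠ[𝓝 z] fun z => z ^ n := by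
    filter_upwards [isOpen_ball.mem_nhds hz] with w hw
    rw [zeroExtend_of_mem _ (mem_ball_zero_iff.1 hw), Complex.UnitDisc.coe_mk]
  rw [h.deriv_eq]
  simp

variable {φ : 𝔻 → 𝔻}

theorem zeroExtend_coe_mem_ball (φ : 𝔻 → 𝔻) (z : ℂ) :
    zeroExtend (fun z => (φ z : ℂ)) z ∈ ball (0 : ℂ) 1 := by
  rw [mem_ball_zero_iff]
  by_cases hz : ‖z‖ < 1
  · rw [zeroExtend_of_mem _ hz]
    exact Complex.UnitDisc.norm_lt_one _
  · simp [zeroExtend, hz]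

theorem zeroExtend_comp (f : 𝔻 → ℂ) (φ : 𝔻 → 𝔻) {z : ℂ} (hz : z ∈ ball (0 : ℂ) 1) :
    zeroExtend (fun z => f (φ z)) z = zeroExtend f (zeroExtend (fun z => (φ z : ℂ)) z) := by
  have hz' := mem_ball_zero_iff.1 hz
  rw [zeroExtend_of_mem _ hz', zeroExtend_of_mem (fun z => (φ z : ℂ)) hz', zeroExtend_coe]

theorem IsHolomorphic.comp {f : 𝔻 → ℂ} (hf : IsHolomorphic f)
    (hφ : IsHolomorphic fun z => (φ z : ℂ)) : IsHolomorphic fun z => f (φ z) :=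
  (DifferentiableOn.comp hf hφ fun z _ => zeroExtend_coe_mem_ball φ z).congr
    fun _ hz => zeroExtend_comp f φ hz

theorem deriv_zeroExtend_comp {f : 𝔻 → ℂ} (hf : IsHolomorphic f)
    (hφ : IsHolomorphic fun z => (φ z : ℂ)) {z : ℂ} (hz : z ∈ ball (0 : ℂ) 1) :
    deriv (zeroExtend fun z => f (φ z)) z =
      deriv (zeroExtend f) (zeroExtend (fun z => (φ z : ℂ)) z) *
        deriv (zeroExtend fun z => (φ z : ℂ)) z := by
  have h : (zeroExtend fun z => f (φ z)) =ᶠ[𝓝 z]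
      zeroExtend f ∘ zeroExtend (fun z => (φ z : ℂ)) := by
    filter_upwards [isOpen_ball.mem_nhds hz] with w hw
    exact zeroExtend_comp f φ hw
  rw [h.deriv_eq, deriv_comp _ (hf.differentiableAt (zeroExtend_coe_mem_ball φ z))
    (hφ.differentiableAt hz)]

/-- The image under `φ` of the measure `|φ'|² dA`: the area measure on the disc weighted by the
counting function of `φ`. -/
def imageMeasure (φ : 𝔻 → 𝔻) : Measure ℂ :=
  (areaMeasure.withDensity fun z => ‖deriv (zeroExtend fun z => (φ z : ℂ)) z‖ₑ ^ 2).map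
    (zeroExtend fun z => (φ z : ℂ))

theorem lintegral_imageMeasure (hφ : IsHolomorphic fun z => (φ z : ℂ)) {F : ℂ → ℝ≥0∞}
    (hF : Measurable F) :
    ∫⁻ w, F w ∂imageMeasure φ =
      ∫⁻ z, ‖deriv (zeroExtend fun z => (φ z : ℂ)) z‖ₑ ^ 2 *
        F (zeroExtend (fun z => (φ z : ℂ)) z) ∂areaMeasure := by
  rw [imageMeasure, lintegral_map hF hφ.measurable, lintegral_withDensity_eq_lintegral_mul]
  · rfl
  · exact (measurable_deriv _).enorm.pow_const 2
  · exact hF.comp hφ.measurable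

theorem ae_mem_ball_imageMeasure (hφ : IsHolomorphic fun z => (φ z : ℂ)) :
    ∀ᵐ w ∂imageMeasure φ, w ∈ ball (0 : ℂ) 1 := by
  rw [imageMeasure]
  refine (ae_map_iff hφ.measurable.aemeasurable measurableSet_ball).2 ?_
  exact Eventually.of_forall (zeroExtend_coe_mem_ball φ)

theorem isFiniteMeasure_imageMeasure (hφ : MemDirichlet fun z => (φ z : ℂ)) :
    IsFiniteMeasure (imageMeasure φ) := by
  refine ⟨?_⟩
  rw [← lintegral_one, lintegral_imageMeasure hφ.1 measurable_const]
  simpa [dirichletIntegral] using hφ.2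

/-- The chain rule and the definition of a pushforward suffice; no injectivity of `φ` or area
formula enters. -/
theorem dirichletIntegral_comp {f : 𝔻 → ℂ} (hf : IsHolomorphic f)
    (hφ : IsHolomorphic fun z => (φ z : ℂ)) :
    dirichletIntegral (fun z => f (φ z)) =
      ∫⁻ w, ‖deriv (zeroExtend f) w‖ₑ ^ 2 ∂imageMeasure φ := by
  rw [lintegral_imageMeasure hφ ((measurable_deriv _).enorm.pow_const 2), dirichletIntegral]
  refine lintegral_congr_ae ?_
  filter_upwards [ae_mem_ball] with z hz
  rw [deriv_zeroExtend_comp hf hφ hz, enorm_mul, mul_pow, mul_comm]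

theorem dirichletIntegral_pow (hφ : IsHolomorphic fun z => (φ z : ℂ)) (n : ℕ) :
    dirichletIntegral (fun z => (φ z : ℂ) ^ n) =
      ∫⁻ w, ‖(n : ℂ) * w ^ (n - 1)‖ₑ ^ 2 ∂imageMeasure φ := by
  rw [dirichletIntegral_comp (isHolomorphic_pow n) hφ]
  refine lintegral_congr_ae ?_
  filter_upwards [ae_mem_ball_imageMeasure hφ] with w hw
  rw [deriv_zeroExtend_pow n hw]

theorem imageMeasure_annulus_le (hφ : IsHolomorphic fun z => (φ z : ℂ)) {h : ℝ} (hh : 0 < h) :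
    imageMeasure φ {w | 1 - h ≤ ‖w‖} ≤
      32 * dirichletIntegral (fun z => (φ z : ℂ) ^ (⌊1 / (4 * h)⌋₊ + 1)) *
        ENNReal.ofReal (h ^ 2) := by
  rw [dirichletIntegral_pow hφ]
  exact annulus_le_moment _ hh

/-- The image measure lives on `|w| < 1`, where the `n`-th moment integrand is at most `n²`. This
handles the finitely many powers that a limit hypothesis leaves uncontrolled. -/
theorem dirichletIntegral_pow_le (hφ : IsHolomorphic fun z => (φ z : ℂ)) (n : ℕ) :
    dirichletIntegral (fun z => (φ z : ℂ) ^ n) ≤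
      (n : ℝ≥0∞) ^ 2 * dirichletIntegral fun z => (φ z : ℂ) := by
  have h1 := dirichletIntegral_pow hφ 1
  simp only [pow_one, le_refl, tsub_eq_zero_of_le, pow_zero, mul_one] at h1
  rw [dirichletIntegral_pow hφ n, h1, ← lintegral_const_mul' _ _ (by simp)]
  refine lintegral_mono_ae ?_
  filter_upwards [ae_mem_ball_imageMeasure hφ] with w hw
  have hw' : ‖w‖ₑ ^ (n - 1) ≤ 1 := by
    refine pow_le_one₀ zero_le ?_
    rw [← ofReal_norm, ENNReal.ofReal_le_one]
    exact (mem_ball_zero_iff.1 hw).le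
  have hn : ‖(n : ℂ)‖ₑ = n := by
    rw [← ofReal_norm, Complex.norm_natCast, ENNReal.ofReal_natCast]
  have h1 : ‖((1 : ℕ) : ℂ)‖ₑ = 1 := by simp
  rw [enorm_mul, enorm_pow, mul_pow, hn, h1, one_pow]
  gcongr
  exact pow_le_one₀ zero_le hw'

/-! ### Pointwise estimates in the Dirichlet space -/

namespace DirichletSpace

theorem norm_sq (f : DirichletSpace) :
    ‖f‖ ^ 2 = ‖f 0‖ ^ 2 + (dirichletIntegral f).toReal :=
  Real.sq_sqrt (by positivity)

theorem ofReal_norm_sq (f : DirichletSpace) :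
    ENNReal.ofReal (‖f‖ ^ 2) = ‖f 0‖ₑ ^ 2 + dirichletIntegral f := by
  rw [norm_sq, ENNReal.ofReal_add (by positivity) (by positivity),
    ENNReal.ofReal_toReal f.memDirichlet.2.ne, ENNReal.ofReal_pow (norm_nonneg _), ofReal_norm]

theorem norm_apply_zero_le (f : DirichletSpace) : ‖f 0‖ ≤ ‖f‖ := by
  refine le_of_sq_le_sq ?_ (norm_nonneg f)
  rw [norm_sq]
  exact le_add_of_nonneg_right ENNReal.toReal_nonneg

theorem dirichletIntegral_le (f : DirichletSpace) :
    dirichletIntegral f ≤ ENNReal.ofReal (‖f‖ ^ 2) := by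
  rw [ofReal_norm_sq]
  exact le_add_self

/-- The sub-mean value inequality for `|f'|²` on the largest disc about `z` inside the unit disc. -/
theorem norm_deriv_le (f : DirichletSpace) {z : ℂ} (hz : ‖z‖ < 1) :
    ‖deriv (zeroExtend f) z‖ ≤ ‖f‖ / (1 - ‖z‖) := by
  have hR : 0 < 1 - ‖z‖ := by linarith
  have hsub : ball z (1 - ‖z‖) ⊆ ball 0 1 := ball_subset_ball' (by simp)
  have h1 := (enorm_sq_le_lintegral_ball hR.le (measurable_deriv (zeroExtend f))
    (f.memDirichlet.1.differentiableOn_deriv.mono hsub)).trans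
      ((lintegral_mono_set hsub).trans (lintegral_areaMeasure _).le)
  have h2 : ENNReal.ofReal (Real.pi * (1 - ‖z‖) ^ 2 * ‖deriv (zeroExtend f) z‖ ^ 2) ≤
      ENNReal.ofReal (Real.pi * ‖f‖ ^ 2) := by
    rw [ENNReal.ofReal_mul (by positivity), ENNReal.ofReal_mul (q := ‖f‖ ^ 2) (by positivity),
      ENNReal.ofReal_pow (norm_nonneg (deriv (zeroExtend f) z)), ofReal_norm]
    refine h1.trans ?_
    gcongr
    exact dirichletIntegral_le f
  rw [ENNReal.ofReal_le_ofReal_iff (by positivity), mul_assoc,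
    mul_le_mul_iff_right₀ Real.pi_pos, ← mul_pow] at h2
  rw [le_div_iff₀ hR, mul_comm]
  exact le_of_sq_le_sq h2 (norm_nonneg f)

theorem norm_sub_le (f : DirichletSpace) {r : ℝ} (hr : r < 1) {z w : ℂ} (hz : ‖z‖ ≤ r)
    (hw : ‖w‖ ≤ r) : ‖zeroExtend f z - zeroExtend f w‖ ≤ ‖f‖ / (1 - r) * ‖z - w‖ := by
  have hball : ∀ x ∈ closedBall (0 : ℂ) r, ‖x‖ ≤ r := fun x hx => mem_closedBall_zero_iff.1 hx
  refine Convex.norm_image_sub_le_of_norm_deriv_le (s := closedBall (0 : ℂ) r)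
    (fun x hx => f.memDirichlet.1.differentiableAt ?_) (fun x hx => ?_) (convex_closedBall _ _)
    (mem_closedBall_zero_iff.2 hw) (mem_closedBall_zero_iff.2 hz)
  · exact mem_ball_zero_iff.2 ((hball x hx).trans_lt hr)
  · refine (f.norm_deriv_le ((hball x hx).trans_lt hr)).trans ?_
    have := hball x hx
    gcongr

theorem norm_apply_le (f : DirichletSpace) (z : 𝔻) :
    ‖f z‖ ≤ (1 + 1 / (1 - ‖(z : ℂ)‖)) * ‖f‖ := by
  have hz := z.norm_lt_one
  have h1 := f.norm_sub_le hz le_rfl (w := ((0 : 𝔻) : ℂ)) (by simp)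
  rw [zeroExtend_coe, zeroExtend_coe, Complex.UnitDisc.coe_zero, sub_zero] at h1
  have h0 : 0 < 1 - ‖(z : ℂ)‖ := by linarith
  have h2 : ‖f‖ / (1 - ‖(z : ℂ)‖) * ‖(z : ℂ)‖ ≤ ‖f‖ / (1 - ‖(z : ℂ)‖) :=
    mul_le_of_le_one_right (by positivity) hz.le
  calc ‖f z‖ = ‖f 0 + (f z - f 0)‖ := by congr 1; ring
    _ ≤ ‖f 0‖ + ‖f z - f 0‖ := norm_add_le _ _
    _ ≤ ‖f‖ + ‖f‖ / (1 - ‖(z : ℂ)‖) := add_le_add f.norm_apply_zero_le (h1.trans h2)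
    _ = _ := by ring

end DirichletSpace

/-! ### Boundedness -/

theorem dirichletIntegral_comp_le (hφ : MemDirichlet fun z => (φ z : ℂ)) {M : ℝ≥0∞}
    (hM : ∀ n : ℕ, 1 ≤ n → dirichletIntegral (fun z => (φ z : ℂ) ^ n) ≤ M)
    {f : 𝔻 → ℂ} (hf : IsHolomorphic f) :
    dirichletIntegral (fun z => f (φ z)) ≤ 36 * (32 * M) * dirichletIntegral f := by
  have := isFiniteMeasure_imageMeasure hφ
  rw [dirichletIntegral_comp hf hφ.1]
  refine lintegral_enorm_sq_le_of_annulus_le (ae_mem_ball_imageMeasure hφ.1) (fun h hh => ?_)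
    (measurable_deriv _) hf.differentiableOn_deriv
  refine (imageMeasure_annulus_le hφ.1 hh).trans ?_
  gcongr
  exact hM _ (by omega)

theorem compositionBounded_of_dirichletIntegral_pow_le (hφ : MemDirichlet fun z => (φ z : ℂ))
    {M : ℝ≥0∞} (hMt : M < ∞)
    (hM : ∀ n : ℕ, 1 ≤ n → dirichletIntegral (fun z => (φ z : ℂ) ^ n) ≤ M) :
    CompositionBounded φ := by
  have hct : 36 * (32 * M) < ∞ := by
    exact ENNReal.mul_lt_top (by simp) (ENNReal.mul_lt_top (by simp) hMt)
  have hmem : ∀ f : DirichletSpace, MemDirichlet fun z => f (φ z) := fun f =>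
    ⟨f.memDirichlet.1.comp hφ.1, (dirichletIntegral_comp_le hφ hM f.memDirichlet.1).trans_lt
      (ENNReal.mul_lt_top hct f.memDirichlet.2)⟩
  let T : DirichletSpace →ₗ[ℂ] DirichletSpace :=
    { toFun := fun f => ⟨fun z => f (φ z), hmem f⟩
      map_add' := fun f g => rfl
      map_smul' := fun c f => rfl }
  -- `K` bounds the evaluation functional at `φ 0`, since `T f` takes the value `f (φ 0)` at the
  -- origin.
  set K : ℝ := 1 + 1 / (1 - ‖(φ 0 : ℂ)‖)
  refine ⟨T.mkContinuous (Real.sqrt (K ^ 2 + (36 * (32 * M)).toReal)) fun f => ?_, fun f z => rfl⟩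
  refine le_of_sq_le_sq ?_ (by positivity)
  rw [mul_pow, Real.sq_sqrt (by positivity), DirichletSpace.norm_sq, add_mul, ← mul_pow]
  gcongr
  · exact f.norm_apply_le (φ 0)
  · have h := dirichletIntegral_comp_le hφ hM f.memDirichlet.1
    calc (dirichletIntegral (T f)).toReal ≤ (36 * (32 * M) * dirichletIntegral f).toReal :=
          ENNReal.toReal_mono (ENNReal.mul_lt_top hct f.memDirichlet.2).ne h
      _ ≤ _ := by
          rw [ENNReal.toReal_mul, DirichletSpace.norm_sq]
          gcongr
          exact le_add_of_nonneg_left (by positivity)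

/-! ### Compactness of the unit ball under locally uniform convergence -/

namespace DirichletSpace

theorem deriv_zeroExtend_sub (f g : DirichletSpace) {z : ℂ} (hz : z ∈ ball (0 : ℂ) 1) :
    deriv (zeroExtend (f - g : DirichletSpace)) z =
      deriv (zeroExtend f) z - deriv (zeroExtend g) z := by
  have h : zeroExtend (f - g : DirichletSpace) = zeroExtend f - zeroExtend g := by
    rw [eq_sub_iff_add_eq, ← zeroExtend_add]
    congr 1
    exact congrArg Subtype.val (sub_add_cancel f g)
  rw [h, deriv_sub (f.memDirichlet.1.differentiableAt hz) (g.memDirichlet.1.differentiableAt hz)]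

/-- The functions on the disc satisfying the growth and Lipschitz estimates shared by all members
of the unit ball of the Dirichlet space. -/
def lipschitzFamily : Set (ball (0 : ℂ) 1 → ℂ) :=
  {F | (∀ z, ‖F z‖ ≤ 1 + 1 / (1 - ‖(z : ℂ)‖)) ∧
    ∀ z w, ‖F z - F w‖ ≤ 1 / (1 - max ‖(z : ℂ)‖ ‖(w : ℂ)‖) * ‖(z : ℂ) - w‖}

theorem isCompact_lipschitzFamily : IsCompact lipschitzFamily := by
  have hpi : IsCompact (Set.pi Set.univ fun z : ball (0 : ℂ) 1 =>
      closedBall (0 : ℂ) (1 + 1 / (1 - ‖(z : ℂ)‖))) :=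
    isCompact_univ_pi fun z => isCompact_closedBall _ _
  refine hpi.of_isClosed_subset ?_ fun F hF z _ => mem_closedBall_zero_iff.2 (hF.1 z)
  have : lipschitzFamily = (⋂ z : ball (0 : ℂ) 1, {F | ‖F z‖ ≤ 1 + 1 / (1 - ‖(z : ℂ)‖)}) ∩
      ⋂ (z : ball (0 : ℂ) 1) (w : ball (0 : ℂ) 1), {F | ‖F z - F w‖ ≤ 1 / (1 - max ‖(z : ℂ)‖ ‖(w : ℂ)‖) * ‖(z : ℂ) - w‖} := by
    ext F; simp only [lipschitzFamily, Set.mem_ofPred_eq, Set.mem_inter_iff, Set.mem_iInter]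
  rw [this]
  refine IsClosed.inter (isClosed_iInter fun z => ?_)
    (isClosed_iInter fun z => isClosed_iInter fun w => ?_)
  · exact isClosed_le (by fun_prop) continuous_const
  · exact isClosed_le (by fun_prop) continuous_const

/-- The Lipschitz constant blows up only at the boundary, so the common modulus at a fixed `z` tends
to `0` as `w → z`. -/
theorem equicontinuous_lipschitzFamily :
    Equicontinuous ((↑) : lipschitzFamily → ball (0 : ℂ) 1 → ℂ) := by
  intro z
  refine Metric.equicontinuousAt_of_continuity_modulus
    (fun w : ball (0 : ℂ) 1 => 1 / (1 - max ‖(z : ℂ)‖ ‖(w : ℂ)‖) * ‖(z : ℂ) - w‖) ?_ _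
    (Eventually.of_forall fun w F => ?_)
  · have hz : 1 - max ‖(z : ℂ)‖ ‖(z : ℂ)‖ ≠ 0 := by
      have := mem_ball_zero_iff.1 z.2
      rw [max_self]; linarith
    have hc : ContinuousAt
        (fun w : ball (0 : ℂ) 1 => 1 / (1 - max ‖(z : ℂ)‖ ‖(w : ℂ)‖) * ‖(z : ℂ) - w‖) z := by
      refine ContinuousAt.mul (ContinuousAt.div continuousAt_const ?_ hz) ?_
      · exact Continuous.continuousAt (by fun_prop)
      · exact Continuous.continuousAt (by fun_prop)
    simpa [ContinuousAt] using hc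
  · rw [dist_eq_norm]
    exact F.2.2 z w

theorem isCompact_setOf_mem_lipschitzFamily :
    IsCompact {F : C(ball (0 : ℂ) 1, ℂ) | (F : ball (0 : ℂ) 1 → ℂ) ∈ lipschitzFamily} := by
  refine ArzelaAscoli.isCompact_of_equicontinuous _ ?_ ?_
  · convert isCompact_lipschitzFamily
    ext F
    -- Equicontinuity makes every member of the pointwise compact family continuous, so the image of
    -- the set in the space of all functions is the whole family.
    refine ⟨?_, fun hF => ⟨⟨F, equicontinuous_lipschitzFamily.continuous ⟨F, hF⟩⟩, hF, rfl⟩⟩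
    rintro ⟨F, hF, rfl⟩
    exact hF
  · exact equicontinuous_lipschitzFamily.comp
      fun F : {F : C(ball (0 : ℂ) 1, ℂ) | (F : ball (0 : ℂ) 1 → ℂ) ∈ lipschitzFamily} =>
        ⟨F.1, F.2⟩

/-- A sequence in the unit ball of the Dirichlet space has a subsequence converging locally
uniformly on the disc. -/
theorem exists_subseq_tendstoLocallyUniformlyOn {f : ℕ → DirichletSpace} (hf : ∀ n, ‖f n‖ ≤ 1) :
    ∃ (g : 𝔻 → ℂ) (ψ : ℕ → ℕ), StrictMono ψ ∧
      TendstoLocallyUniformlyOn (fun n => zeroExtend (f (ψ n))) (zeroExtend g) atTop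
        (ball 0 1) := by
  -- On a locally compact space, compact-open convergence is locally uniform convergence.
  have : LocallyCompactSpace (ball (0 : ℂ) 1) := isOpen_ball.locallyCompactSpace
  let F : ℕ → C(ball (0 : ℂ) 1, ℂ) := fun n =>
    ⟨(ball (0 : ℂ) 1).domRestrict (zeroExtend (f n)),
      (DifferentiableOn.continuousOn (f n).memDirichlet.1).domRestrict⟩
  have hF : ∀ n, F n ∈ {F : C(ball (0 : ℂ) 1, ℂ) | (F : ball (0 : ℂ) 1 → ℂ) ∈ lipschitzFamily} := by
    refine fun n => ⟨fun z => ?_, fun z w => ?_⟩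
    · have hz : ‖(z : ℂ)‖ < 1 := mem_ball_zero_iff.1 z.2
      have h := (f n).norm_apply_le (Complex.UnitDisc.mk z hz)
      have h0 : 0 < 1 - ‖(z : ℂ)‖ := by linarith
      rw [← zeroExtend_of_mem (f n) hz, Complex.UnitDisc.coe_mk] at h
      exact h.trans (mul_le_of_le_one_right (by positivity) (hf n))
    · have hm : max ‖(z : ℂ)‖ ‖(w : ℂ)‖ < 1 :=
        max_lt (mem_ball_zero_iff.1 z.2) (mem_ball_zero_iff.1 w.2)
      refine ((f n).norm_sub_le hm (le_max_left _ _) (le_max_right _ _)).trans ?_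
      have h0 : 0 < 1 - max ‖(z : ℂ)‖ ‖(w : ℂ)‖ := by linarith
      gcongr
      exact hf n
  obtain ⟨G, -, ψ, hψ, hG⟩ := isCompact_setOf_mem_lipschitzFamily.isSeqCompact hF
  refine ⟨fun z => G ⟨z, mem_ball_zero_iff.2 z.norm_lt_one⟩, ψ, hψ, ?_⟩
  rw [tendstoLocallyUniformlyOn_iff_tendstoLocallyUniformly_comp_coe]
  rw [ContinuousMap.tendsto_iff_tendstoLocallyUniformly] at hG
  have hGz : zeroExtend (fun z => G ⟨z, mem_ball_zero_iff.2 z.norm_lt_one⟩) ∘ Subtype.val = G :=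
    funext fun z => zeroExtend_of_mem _ (mem_ball_zero_iff.1 z.2)
  rw [hGz]
  exact hG

/-- The closed unit ball of the Dirichlet space is closed under locally uniform limits. -/
theorem exists_eq_of_tendstoLocallyUniformlyOn {f : ℕ → DirichletSpace} (hf : ∀ n, ‖f n‖ ≤ 1)
    {g : 𝔻 → ℂ} (hg : TendstoLocallyUniformlyOn (fun n => zeroExtend (f n)) (zeroExtend g) atTop
      (ball 0 1)) : ∃ G : DirichletSpace, (G : 𝔻 → ℂ) = g ∧ ‖G‖ ≤ 1 := by
  have hd : ∀ᶠ n in atTop, DifferentiableOn ℂ (zeroExtend (f n)) (ball 0 1) :=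
    Eventually.of_forall fun n => (f n).memDirichlet.1
  have hol : IsHolomorphic g := hg.differentiableOn hd isOpen_ball
  have hderiv := hg.deriv hd isOpen_ball
  have h0 : Tendsto (fun n => 1 - ‖f n 0‖ₑ ^ 2) atTop (𝓝 (1 - ‖g 0‖ₑ ^ 2)) := by
    have h := hg.tendsto_at (a := ((0 : 𝔻) : ℂ)) (by simp)
    simp only [zeroExtend_coe] at h
    exact ENNReal.Tendsto.sub tendsto_const_nhds ((ENNReal.continuous_pow 2).tendsto _ |>.comp
      h.enorm) (Or.inl ENNReal.one_ne_top)
  have hsum : ∀ n, ‖f n 0‖ₑ ^ 2 + dirichletIntegral (f n) ≤ 1 := fun n => by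
    rw [← ofReal_norm_sq, ENNReal.ofReal_le_one]
    exact pow_le_one₀ (norm_nonneg _) (hf n)
  have hg0 : ‖g 0‖ₑ ^ 2 ≤ 1 := by
    have h := hg.tendsto_at (a := ((0 : 𝔻) : ℂ)) (by simp)
    simp only [zeroExtend_coe] at h
    exact le_of_tendsto' ((ENNReal.continuous_pow 2).tendsto _ |>.comp h.enorm)
      fun n => le_self_add.trans (hsum n)
  -- Fatou for the pointwise convergent derivatives. Keeping `1 - |f n 0|²` as the bound, rather
  -- than `1`, preserves the radius of the ball in the limit.
  have hD : dirichletIntegral g ≤ 1 - ‖g 0‖ₑ ^ 2 := by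
    calc dirichletIntegral g
        = ∫⁻ z, liminf (fun n => ‖deriv (zeroExtend (f n)) z‖ₑ ^ 2) atTop ∂areaMeasure := by
          refine lintegral_congr_ae ?_
          filter_upwards [ae_mem_ball] with z hz
          exact (((ENNReal.continuous_pow 2).tendsto _).comp
            (hderiv.tendsto_at hz).enorm).liminf_eq.symm
      _ ≤ liminf (fun n => dirichletIntegral (f n)) atTop :=
          lintegral_liminf_le fun n => (measurable_deriv _).enorm.pow_const 2
      _ ≤ liminf (fun n => 1 - ‖f n 0‖ₑ ^ 2) atTop :=
          liminf_le_liminf (Eventually.of_forall fun n =>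
            ENNReal.le_sub_of_add_le_left (by simp) (hsum n))
      _ = 1 - ‖g 0‖ₑ ^ 2 := h0.liminf_eq
  let G : DirichletSpace := ⟨g, hol, hD.trans_lt (tsub_le_self.trans_lt ENNReal.one_lt_top)⟩
  refine ⟨G, rfl, ?_⟩
  refine (sq_le_one_iff₀ (norm_nonneg G)).1 (ENNReal.ofReal_le_one.1 ?_)
  rw [ofReal_norm_sq G]
  calc ‖g 0‖ₑ ^ 2 + dirichletIntegral g ≤ ‖g 0‖ₑ ^ 2 + (1 - ‖g 0‖ₑ ^ 2) := by gcongr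
    _ = 1 := add_tsub_cancel_of_le hg0

end DirichletSpace

/-! ### Compactness of the composition operator -/

/-- Under the vanishing condition the part of the image measure near the boundary has arbitrarily
small Carleson constant. -/
theorem exists_restrict_imageMeasure_annulus_le (hφ : IsHolomorphic fun z => (φ z : ℂ))
    (hlim : Tendsto (fun n : ℕ => dirichletIntegral fun z => (φ z : ℂ) ^ n) atTop (𝓝 0))
    {δ : ℝ≥0∞} (hδ : 0 < δ) :
    ∃ η : ℝ, 0 < η ∧ ∀ h : ℝ, 0 < h →
      (imageMeasure φ).restrict {w | 1 - η ≤ ‖w‖} {w | 1 - h ≤ ‖w‖} ≤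
        32 * δ * ENNReal.ofReal (h ^ 2) := by
  obtain ⟨N, hN⟩ := eventually_atTop.1 (ENNReal.tendsto_nhds_zero.1 hlim δ hδ)
  have hη : (0 : ℝ) < 1 / (4 * (N + 1)) := by positivity
  -- For `k` up to this width the exponent `⌊1/(4k)⌋ + 1` exceeds `N`.
  refine ⟨1 / (4 * (N + 1)), hη, fun h hh => ?_⟩
  have key : ∀ k : ℝ, 0 < k → k ≤ 1 / (4 * (N + 1)) →
      imageMeasure φ {w | 1 - k ≤ ‖w‖} ≤ 32 * δ * ENNReal.ofReal (k ^ 2) := fun k hk hkη => by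
    refine (imageMeasure_annulus_le hφ hk).trans ?_
    gcongr
    refine hN _ (Nat.le_succ_of_le (Nat.le_floor ?_))
    rw [le_div_iff₀ (by positivity)] at hkη ⊢
    nlinarith
  rw [Measure.restrict_apply (measurableSet_le measurable_const measurable_norm)]
  rcases le_total h (1 / (4 * (N + 1))) with hle | hle
  · exact (measure_mono Set.inter_subset_left).trans (key h hh hle)
  -- For wider annuli the restricted mass is at most that of the annulus of width `η`, and `η² ≤
  -- h²`.
  · refine (measure_mono Set.inter_subset_right).trans ((key _ hη le_rfl).trans ?_)
    gcongr

theorem tendsto_dirichletIntegral_comp_sub (hφ : MemDirichlet fun z => (φ z : ℂ))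
    (hlim : Tendsto (fun n : ℕ => dirichletIntegral fun z => (φ z : ℂ) ^ n) atTop (𝓝 0))
    {f : ℕ → DirichletSpace} {g : DirichletSpace} (hfg : ∀ n, ‖f n - g‖ ≤ 2)
    (hconv : TendstoLocallyUniformlyOn (fun n => deriv (zeroExtend (f n))) (deriv (zeroExtend g))
      atTop (ball 0 1)) :
    Tendsto (fun n => dirichletIntegral fun z => (f n - g) (φ z)) atTop (𝓝 0) := by
  have := isFiniteMeasure_imageMeasure hφ
  rw [ENNReal.tendsto_nhds_zero]
  intro ε hε
  have hε2 : 0 < ε / 2 := ENNReal.half_pos hε.ne'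
  -- The factor `36 * 32` comes from the Carleson and annulus bounds, `4` from `‖f n - g‖² ≤ 4`.
  obtain ⟨η, hη, hann⟩ := exists_restrict_imageMeasure_annulus_le hφ.1 hlim
    (δ := ε / 2 / (36 * 32 * 4)) (ENNReal.div_pos hε2.ne' (by finiteness))
  set μ := imageMeasure φ
  set A : Set ℂ := {w | 1 - η ≤ ‖w‖} with hA
  have hAm : MeasurableSet A := measurableSet_le measurable_const measurable_norm
  -- Finite total mass lets uniform closeness `κ` of the derivatives on `|w| ≤ 1 - η` control the
  -- inner integral.
  obtain ⟨κ, hκ, hκ0⟩ : ∃ κ : ℝ, ENNReal.ofReal κ ^ 2 * μ Set.univ ≤ ε / 2 ∧ 0 < κ := by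
    have ht : Tendsto (fun κ : ℝ => ENNReal.ofReal κ ^ 2 * μ Set.univ) (𝓝[>] 0) (𝓝 0) := by
      have : Continuous fun κ : ℝ => ENNReal.ofReal κ ^ 2 * μ Set.univ :=
        (ENNReal.continuous_mul_const (measure_ne_top μ _)).comp
          ((ENNReal.continuous_pow 2).comp ENNReal.continuous_ofReal)
      simpa using (this.tendsto 0).mono_left nhdsWithin_le_nhds
    exact ((ENNReal.tendsto_nhds_zero.1 ht _ hε2).and self_mem_nhdsWithin).exists
  have hunif : ∀ᶠ n in atTop, ∀ w ∈ closedBall (0 : ℂ) (1 - η),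
      dist (deriv (zeroExtend g) w) (deriv (zeroExtend (f n)) w) < κ :=
    Metric.tendstoUniformlyOn_iff.1
      ((tendstoLocallyUniformlyOn_iff_forall_isCompact isOpen_ball).1 hconv _
        (closedBall_subset_ball (by linarith)) (isCompact_closedBall _ _)) κ hκ0
  filter_upwards [hunif] with n hn
  rw [dirichletIntegral_comp (f n - g).memDirichlet.1 hφ.1, ← lintegral_add_compl _ hAm]
  refine (add_le_add ?_ ?_).trans (ENNReal.add_halves ε).le
  · refine (lintegral_enorm_sq_le_of_annulus_le
      (ae_restrict_of_ae (ae_mem_ball_imageMeasure hφ.1)) hann (measurable_deriv _)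
      (f n - g).memDirichlet.1.differentiableOn_deriv).trans ?_
    have hD : dirichletIntegral (f n - g : DirichletSpace) ≤ 4 := by
      refine (f n - g).dirichletIntegral_le.trans ?_
      rw [ENNReal.ofReal_le_iff_le_toReal (by simp)]
      have := pow_le_pow_left₀ (norm_nonneg _) (hfg n) 2
      norm_num at this ⊢
      exact this
    calc 36 * (32 * (ε / 2 / (36 * 32 * 4))) * dirichletIntegral (f n - g : DirichletSpace)
        ≤ 36 * (32 * (ε / 2 / (36 * 32 * 4))) * 4 := by gcongr
      _ = 36 * 32 * 4 * (ε / 2 / (36 * 32 * 4)) := by ring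
      _ = ε / 2 := ENNReal.mul_div_cancel (by norm_num) (by finiteness)
  · calc ∫⁻ w in Aᶜ, ‖deriv (zeroExtend (f n - g : DirichletSpace)) w‖ₑ ^ 2 ∂μ
        ≤ ∫⁻ _ in Aᶜ, ENNReal.ofReal κ ^ 2 ∂μ := by
          refine setLIntegral_mono' hAm.compl fun w hw => ?_
          have hw' : ‖w‖ < 1 - η := not_le.1 hw
          have hwb : w ∈ ball (0 : ℂ) 1 := mem_ball_zero_iff.2 (by linarith)
          have hκw := hn w (mem_closedBall_zero_iff.2 hw'.le)
          rw [dist_comm, dist_eq_norm, ← DirichletSpace.deriv_zeroExtend_sub _ _ hwb] at hκw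
          rw [← ofReal_norm]
          gcongr
      _ ≤ ∫⁻ _, ENNReal.ofReal κ ^ 2 ∂μ := setLIntegral_le_lintegral _ _
      _ ≤ ε / 2 := by rwa [lintegral_const]

/-- Convergence in `[0, ∞]` bounds only a tail; the initial powers are bounded through the
finiteness of `D(φ)`. -/
theorem exists_dirichletIntegral_pow_le (hφ : MemDirichlet fun z => (φ z : ℂ))
    (hlim : Tendsto (fun n : ℕ => dirichletIntegral fun z => (φ z : ℂ) ^ n) atTop (𝓝 0)) :
    ∃ M : ℝ≥0∞, M < ∞ ∧ ∀ n : ℕ, dirichletIntegral (fun z => (φ z : ℂ) ^ n) ≤ M := by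
  obtain ⟨N, hN⟩ := eventually_atTop.1 (ENNReal.tendsto_nhds_zero.1 hlim 1 one_pos)
  refine ⟨max 1 ((N : ℝ≥0∞) ^ 2 * dirichletIntegral fun z => (φ z : ℂ)),
    max_lt ENNReal.one_lt_top (ENNReal.mul_lt_top (by finiteness) hφ.2), fun n => ?_⟩
  rcases le_total N n with h | h
  · exact (hN n h).trans (le_max_left _ _)
  · refine (dirichletIntegral_pow_le hφ.1 n).trans (le_trans ?_ (le_max_right _ _))
    gcongr

theorem compositionCompact_of_tendsto (hφ : MemDirichlet fun z => (φ z : ℂ))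
    (hlim : Tendsto (fun n : ℕ => dirichletIntegral fun z => (φ z : ℂ) ^ n) atTop (𝓝 0)) :
    CompositionCompact φ := by
  obtain ⟨M, hMt, hM⟩ := exists_dirichletIntegral_pow_le hφ hlim
  obtain ⟨T, hT⟩ := compositionBounded_of_dirichletIntegral_pow_le hφ hMt fun n _ => hM n
  -- The image of the closed unit ball is itself compact, without taking a closure, because the ball
  -- is closed under locally uniform limits.
  refine ⟨T, hT, T '' closedBall 0 1, IsSeqCompact.isCompact fun y hy => ?_,
    mem_of_superset (closedBall_mem_nhds 0 one_pos) (Set.subset_preimage_image _ _)⟩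
  choose f hf hfy using hy
  have hf1 : ∀ n, ‖f n‖ ≤ 1 := fun n => mem_closedBall_zero_iff.1 (hf n)
  obtain ⟨g, ψ, hψ, hg⟩ := DirichletSpace.exists_subseq_tendstoLocallyUniformlyOn hf1
  obtain ⟨G, rfl, hG⟩ := DirichletSpace.exists_eq_of_tendstoLocallyUniformlyOn
    (fun n => hf1 (ψ n)) hg
  refine ⟨T G, Set.mem_image_of_mem _ (mem_closedBall_zero_iff.2 hG), ψ, hψ, ?_⟩
  have hTfun : ∀ u : DirichletSpace, (T u : 𝔻 → ℂ) = fun z => u (φ z) := fun u => funext (hT u)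
  have hD := tendsto_dirichletIntegral_comp_sub hφ hlim (f := fun n => f (ψ n)) (g := G)
    (fun n => (norm_sub_le _ _).trans (by linarith [hf1 (ψ n)]))
    (hg.deriv (Eventually.of_forall fun n => (f (ψ n)).memDirichlet.1) isOpen_ball)
  have h0 : Tendsto (fun n => ‖(f (ψ n) - G) (φ 0)‖ₑ ^ 2) atTop (𝓝 0) := by
    have h := (hg.tendsto_at (mem_ball_zero_iff.2 (φ 0).norm_lt_one)).sub_const (G (φ 0))
    simp only [zeroExtend_coe, sub_self] at h
    have h2 := ((ENNReal.continuous_pow 2).tendsto _).comp h.enorm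
    rw [enorm_zero, zero_pow two_ne_zero] at h2
    exact h2
  have hsq : Tendsto (fun n => ENNReal.ofReal (‖T (f (ψ n) - G)‖ ^ 2)) atTop (𝓝 0) := by
    simp only [DirichletSpace.ofReal_norm_sq, hTfun]
    simpa using h0.add hD
  rw [tendsto_iff_norm_sub_tendsto_zero]
  have hreal := (ENNReal.tendsto_toReal ENNReal.zero_ne_top).comp hsq
  have hsqrt := (Real.continuous_sqrt.tendsto _).comp hreal
  simpa [Function.comp_def, ENNReal.toReal_ofReal, Real.sqrt_sq, ← hfy, ← map_sub] using hsqrt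

end DirichletComposition

end

theorem mainTheorem2 (φ : Complex.UnitDisc → Complex.UnitDisc)
    (hφ : DirichletComposition.MemDirichlet (fun z => (φ z : ℂ))) :
    ((⨆ (n : ℕ) (_ : 1 ≤ n),
        DirichletComposition.dirichletIntegral (fun z => (φ z : ℂ) ^ n)) < (⊤ : ENNReal) →
      DirichletComposition.CompositionBounded φ) ∧
    (Filter.Tendsto
        (fun n : ℕ => DirichletComposition.dirichletIntegral (fun z => (φ z : ℂ) ^ n))
        Filter.atTop (nhds 0) →
      DirichletComposition.CompositionCompact φ) :=
  ⟨fun h => DirichletComposition.compositionBounded_of_dirichletIntegral_pow_le hφ h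
      fun n hn => le_iSup₂ (f := fun (n : ℕ) (_ : 1 ≤ n) =>
        DirichletComposition.dirichletIntegral fun z => (φ z : ℂ) ^ n) n hn,
    DirichletComposition.compositionCompact_of_tendsto hφ⟩
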